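/- Let $\{0,1\}^n$ be the set of binary words of length $n$; the weight of a word is the number of its nonzero entries, and the Johnson distance of two words of the same weight is half of their Hamming distance. For integers $n\ge 1$, $d\ge 0$ and $0\le w\le n$, let $A(n,d,w)$ be the largest size of a set of words in $\{0,1\}^n$ of weight $w$, any two distinct members of which have Johnson distance at least $d$, and let $$V_w(n,d)=\sum_{i=0}^{d}\binom{w}{i}\binom{n-w}{i}$$ be the volume of a Johnson ball of radius $d$. Theorem. Let $\alpha$ and $\lambda$ be real constants with $0<\alpha<\lambda(1-\lambda)$. There is a constant $c>0$, depending only on $\alpha$ and $\lambda$, such that for every integer $n\ge 1$, with $d=\alpha n$ and $w=\lambda n$ (where, if these numbers are not integers, each of them may be rounded either down or up to an adjacent integer), $$A(n,d+1,w)\ \ge\ c\,n\,\frac{\binom{n}{w}}{V_w(n,d)}.$$ -/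

import Mathlib

/-- Johnson distance of two binary words (of the same weight): half of their Hamming distance.
It is taken in `ℚ`, so that the division by `2` is exact. -/
def johnsonDist {n : ℕ} (x y : Fin n → Fin 2) : ℚ :=
  (hammingDist x y : ℚ) / 2

/-- `C ⊆ {0,1}ⁿ` is a constant-weight code: every codeword has weight `w` (`hammingNorm` counts the
nonzero entries) and any two distinct codewords have Johnson distance at least `d`. -/
def IsConstantWeightCode (n d w : ℕ) (C : Finset (Fin n → Fin 2)) : Prop :=
  (∀ x ∈ C, hammingNorm x = w) ∧
    ∀ x ∈ C, ∀ y ∈ C, x ≠ y → (d : ℚ) ≤ johnsonDist x y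

open Classical in
/-- `A(n,d,w)`: the largest size of a constant-weight code of length `n`, weight `w` and minimum
Johnson distance at least `d` (a maximum over a finite family containing the empty code). -/
noncomputable def maxConstantWeightCodeSize (n d w : ℕ) : ℕ :=
  (Finset.univ.filter fun C : Finset (Fin n → Fin 2) => IsConstantWeightCode n d w C).sup
    Finset.card

/-- `V_w(n,d)`: the volume of a Johnson ball of radius `d` among the words of length `n` and
weight `w ≤ n`. -/
def johnsonBallVolume (w n d : ℕ) : ℕ :=
  ∑ i ∈ Finset.range (d + 1), w.choose i * (n - w).choose i

/-! Codes of minimum Johnson distance `d + 1` are the independent sets of the graph joining words of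
weight `w` at distance at most `d`. Its degrees are at most the ball volume `V`, so a greedy choice
already gives `n.choose w / V`. The extra factor `n` comes from local sparsity: only an
exponentially small fraction of the pairs in a ball are close to each other.

Sparsity enters through a random independent set `I` of the hard-core model
(`mul_card_le_of_locally_sparse`). Fix the part of `I` outside the closed neighbourhood of `v`. If
many neighbours remain free, sparsity forces many of them to be occupied on average; if few do, `v`
itself is occupied often enough. In both cases `D * P(v ∈ I) + E|I ∩ N(v)| ≥ B`, and summing over
`v` bounds the independence number below. A fraction `exp (-2μ)` of close pairs gives `B = (μ - 1) /
6`, and `μ` can be taken linear in `n`.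

Sparsity itself (`card_johnsonTriangles_le`) is a Chernoff bound: with exponential weights the count
factors over coordinates. The exponent is negative because `d / w + d / (n - w)` stays below `1`,
which asymptotically is `α < lam * (1 - lam)`. -/

/-! ### The hard-core model on locally sparse graphs -/

namespace SimpleGraph

variable {V : Type*} (G : SimpleGraph V)

open Classical in
/-- The independent subsets of a finite set of vertices. -/
noncomputable def indepSubsets (J : Finset V) : Finset (Finset V) :=
  J.powerset.filter fun A => G.IsIndepSet A

/-- The partition function of the hard-core model with fugacity `l` on a finite set of vertices. -/
noncomputable def hardCore (l : ℝ) (J : Finset V) : ℝ :=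
  ∑ A ∈ G.indepSubsets J, l ^ A.card

open Classical in
/-- The total weight in the hard-core model on `J` of the independent sets that contain `u`. -/
noncomputable def hardCoreAt (l : ℝ) (J : Finset V) (u : V) : ℝ :=
  ∑ A ∈ G.indepSubsets J with u ∈ A, l ^ A.card

variable {G} {l : ℝ} {J : Finset V}

lemma mem_indepSubsets {A : Finset V} :
    A ∈ G.indepSubsets J ↔ A ⊆ J ∧ G.IsIndepSet A := by
  simp [indepSubsets]

lemma one_le_hardCore (hl : 0 ≤ l) : 1 ≤ G.hardCore l J := by
  have h : (∅ : Finset V) ∈ G.indepSubsets J := by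
    simp [mem_indepSubsets, IsIndepSet]
  simpa [hardCore] using Finset.single_le_sum (f := fun A : Finset V => l ^ A.card)
    (fun A _ => pow_nonneg hl _) h

lemma hardCore_le_exp (hl : 0 ≤ l) : G.hardCore l J ≤ Real.exp (l * J.card) := by
  classical
  have h1 : G.hardCore l J ≤ ∑ A ∈ J.powerset, l ^ A.card :=
    Finset.sum_le_sum_of_subset_of_nonneg (Finset.filter_subset _ _)
      fun A _ _ => pow_nonneg hl _
  have h2 : ∑ A ∈ J.powerset, l ^ A.card = (l + 1) ^ J.card := by
    simpa using Finset.sum_pow_mul_eq_add_pow l 1 J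
  calc G.hardCore l J ≤ (l + 1) ^ J.card := h1.trans h2.le
    _ ≤ Real.exp l ^ J.card := by
        gcongr
        exact Real.add_one_le_exp l
    _ = Real.exp (l * J.card) := by rw [← Real.exp_nat_mul, mul_comm]

-- Deleting `u` is a bijection onto the independent sets to which `u` can be added, and it costs one
-- factor `l`.
open Classical in
lemma hardCoreAt_eq {u : V} (hu : u ∈ J) :
    G.hardCoreAt l J u =
      l * ∑ A ∈ G.indepSubsets J with u ∉ A ∧ ∀ v ∈ A, ¬ G.Adj u v, l ^ A.card := by
  rw [hardCoreAt, Finset.mul_sum]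
  refine Finset.sum_nbij' (fun A => A.erase u) (fun A => insert u A) ?_ ?_ ?_ ?_ ?_
  · intro A hA
    simp only [Finset.mem_filter, mem_indepSubsets] at hA ⊢
    obtain ⟨⟨hAJ, hA⟩, huA⟩ := hA
    refine ⟨⟨(Finset.erase_subset _ _).trans hAJ, hA.mono (by simp)⟩, by simp, ?_⟩
    intro v hv
    rw [Finset.mem_erase] at hv
    exact hA (by exact_mod_cast huA) (by exact_mod_cast hv.2) hv.1.symm
  · intro A hA
    simp only [Finset.mem_filter, mem_indepSubsets] at hA ⊢
    obtain ⟨⟨hAJ, hA⟩, huA, hadj⟩ := hA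
    refine ⟨⟨Finset.insert_subset hu hAJ, ?_⟩, by simp⟩
    rw [Finset.coe_insert]
    exact hA.insert fun v hv _ => ⟨hadj v hv, fun h => hadj v hv h.symm⟩
  · intro A hA
    exact Finset.insert_erase (Finset.mem_filter.1 hA).2
  · intro A hA
    exact Finset.erase_insert (Finset.mem_filter.1 hA).2.1
  · intro A hA
    rw [← Finset.card_erase_add_one (Finset.mem_filter.1 hA).2, pow_succ, mul_comm]

lemma hardCoreAt_le (hl : 0 ≤ l) {u : V} (hu : u ∈ J) :
    G.hardCoreAt l J u ≤ l * G.hardCore l J := by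
  classical
  rw [hardCoreAt_eq hu]
  exact mul_le_mul_of_nonneg_left (Finset.sum_le_sum_of_subset_of_nonneg
    (Finset.filter_subset _ _) fun A _ _ => pow_nonneg hl _) hl

-- An independent set contains `u`, can be extended by `u`, or meets the neighbourhood of `u`. The
-- second class is controlled by `hardCoreAt_eq`, the third by a union bound with `hardCoreAt_le`.
open Classical in
lemma le_hardCoreAt (hl : 0 ≤ l) {u : V} (hu : u ∈ J) :
    l * (1 - l * (J.filter (G.Adj u)).card) * G.hardCore l J ≤
      (1 + l) * G.hardCoreAt l J u := by
  set F := ∑ A ∈ G.indepSubsets J with u ∉ A ∧ ∀ v ∈ A, ¬ G.Adj u v, l ^ A.card with hF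
  have hcover : G.hardCore l J ≤
      G.hardCoreAt l J u + F + ∑ v ∈ J.filter (G.Adj u), G.hardCoreAt l J v := by
    have hAt : ∀ v, G.hardCoreAt l J v =
        ∑ A ∈ G.indepSubsets J, if v ∈ A then l ^ A.card else 0 := fun v => by
      rw [hardCoreAt, Finset.sum_filter]
    simp only [hAt]
    rw [Finset.sum_comm, hF, Finset.sum_filter, ← Finset.sum_add_distrib,
      ← Finset.sum_add_distrib]
    refine Finset.sum_le_sum fun A hA => ?_
    have hn : 0 ≤ l ^ A.card := pow_nonneg hl _
    have hs : ∀ v ∈ J.filter (G.Adj u), 0 ≤ if v ∈ A then l ^ A.card else 0 := fun v _ => by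
      split_ifs <;> simp [hn]
    have hs' := Finset.sum_nonneg hs
    by_cases h1 : u ∈ A
    · simp only [h1, if_true, not_true_eq_false, false_and, if_false]
      linarith
    by_cases h2 : ∀ v ∈ A, ¬ G.Adj u v
    · rw [if_neg h1, if_pos ⟨h1, h2⟩]
      linarith
    · rw [if_neg h1, if_neg fun h => h2 h.2]
      push Not at h2
      obtain ⟨v, hv, hadj⟩ := h2
      have := Finset.single_le_sum hs
        (Finset.mem_filter.2 ⟨(mem_indepSubsets.1 hA).1 hv, hadj⟩)
      rw [if_pos hv] at this
      linarith
  have hnb : ∑ v ∈ J.filter (G.Adj u), G.hardCoreAt l J v ≤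
      (J.filter (G.Adj u)).card * (l * G.hardCore l J) := by
    rw [← nsmul_eq_mul]
    exact Finset.sum_le_card_nsmul _ _ _ fun v hv => hardCoreAt_le hl (Finset.mem_filter.1 hv).1
  have hEq : G.hardCoreAt l J u = l * F := hardCoreAt_eq hu
  have := mul_le_mul_of_nonneg_left (hcover.trans (add_le_add_right hnb _)) hl
  nlinarith

lemma sum_hardCoreAt :
    ∑ u ∈ J, G.hardCoreAt l J u = ∑ A ∈ G.indepSubsets J, (A.card : ℝ) * l ^ A.card := by
  classical
  simp only [hardCoreAt, Finset.sum_filter]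
  rw [Finset.sum_comm]
  refine Finset.sum_congr rfl fun A hA => ?_
  rw [← Finset.sum_filter, Finset.sum_const, nsmul_eq_mul,
    Finset.filter_mem_eq_inter, Finset.inter_eq_right.2 (mem_indepSubsets.1 hA).1]

open Classical in
/-- A lower bound for the mean size of a random independent set of a sparse graph. -/
lemma le_sum_card_mul (hl : 0 ≤ l) (hl1 : l ≤ 1)
    (hM : l ^ 2 * ∑ u ∈ J, ((J.filter (G.Adj u)).card : ℝ) ≤ 1) :
    (l * J.card - 1) * G.hardCore l J ≤
      2 * ∑ A ∈ G.indepSubsets J, (A.card : ℝ) * l ^ A.card := by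
  rw [← sum_hardCoreAt]
  have h0 : ∀ u, 0 ≤ G.hardCoreAt l J u := fun u => Finset.sum_nonneg fun A _ => pow_nonneg hl _
  have h1 := Finset.sum_le_sum fun u (hu : u ∈ J) => le_hardCoreAt (G := G) hl hu
  rw [← Finset.sum_mul, ← Finset.mul_sum, ← Finset.mul_sum, Finset.sum_sub_distrib,
    ← Finset.mul_sum] at h1
  simp only [Finset.sum_const, nsmul_eq_mul, mul_one] at h1
  have h2 : 0 ≤ ∑ u ∈ J, G.hardCoreAt l J u := Finset.sum_nonneg fun u _ => h0 u
  have h3 : 1 ≤ G.hardCore l J := one_le_hardCore hl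
  nlinarith [mul_le_mul_of_nonneg_right hM (zero_le_one.trans h3)]

open Classical in
/-- The local estimate at a vertex whose free neighbourhood is `J`. -/
lemma mul_add_hardCore_le (hl : 0 ≤ l) (hl1 : l ≤ 1)
    (hM : l ^ 2 * ∑ u ∈ J, ((J.filter (G.Adj u)).card : ℝ) ≤ 1) {B D : ℝ} (hB : 0 ≤ B)
    (hD : Real.exp (6 * B + 1) ≤ l * D) :
    B * (l + G.hardCore l J) ≤
      D * l + ∑ A ∈ G.indepSubsets J, (A.card : ℝ) * l ^ A.card := by
  have h1 := le_sum_card_mul hl hl1 hM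
  have hZ : 1 ≤ G.hardCore l J := one_le_hardCore hl
  have hS : 0 ≤ ∑ A ∈ G.indepSubsets J, (A.card : ℝ) * l ^ A.card :=
    Finset.sum_nonneg fun A _ => by positivity
  -- If `l * |J| ≥ 4B + 1`, the mean size is at least `2B`, which suffices since `l ≤ 1 ≤ Z`.
  -- Otherwise `Z ≤ exp (4B + 1)`, and the remaining factor `exp (2B) ≥ 2B + 1` of `l * D` pays for
  -- `2B * Z`.
  rcases le_total (4 * B + 1) (l * J.card) with h | h
  · have : 0 ≤ D * l := by linarith [Real.exp_pos (6 * B + 1)]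
    nlinarith [mul_le_mul_of_nonneg_right h (zero_le_one.trans hZ)]
  · have hZ' : G.hardCore l J ≤ Real.exp (4 * B + 1) :=
      (hardCore_le_exp hl).trans (Real.exp_le_exp.2 h)
    have h2 : Real.exp (6 * B + 1) = Real.exp (2 * B) * Real.exp (4 * B + 1) := by
      rw [← Real.exp_add]; ring_nf
    have h3 := Real.add_one_le_exp (2 * B)
    have h4 := mul_le_mul_of_nonneg_right h3 (Real.exp_pos (4 * B + 1)).le
    nlinarith

variable [Fintype V] {v : V} {O : Finset V}

open Classical in
/-- Splitting the independent sets according to their part outside a closed neighbourhood. -/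
lemma sum_indepSubsets_fiber (hO : G.IsIndepSet O) (hv : ∀ u ∈ O, u ≠ v ∧ ¬ G.Adj v u)
    (f : Finset V → ℝ) :
    ∑ I ∈ G.indepSubsets Finset.univ with I.filter (fun u => u ≠ v ∧ ¬ G.Adj v u) = O, f I =
      f (insert v O) + ∑ A ∈ G.indepSubsets
        (Finset.univ.filter fun u => G.Adj v u ∧ ∀ w ∈ O, ¬ G.Adj u w), f (O ∪ A) := by
  have hvO : v ∉ O := fun h => (hv v h).1 rfl
  -- If `v ∈ I`, no neighbour of `v` is present; otherwise the missing part is any independent set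
  -- of neighbours of `v` that have no neighbour in `O`.
  rw [← Finset.sum_filter_add_sum_filter_not _ (fun I => v ∈ I)]
  congr 1
  · rw [← Finset.sum_singleton f (insert v O)]
    refine Finset.sum_congr ?_ fun _ _ => rfl
    ext I
    simp only [Finset.mem_filter, mem_indepSubsets, Finset.subset_univ, true_and,
      Finset.mem_singleton]
    constructor
    · rintro ⟨⟨hI, rfl⟩, hvI⟩
      ext u
      simp only [Finset.mem_insert, Finset.mem_filter]
      constructor
      · intro hu
        by_cases huv : u = v
        · exact Or.inl huv
        · exact Or.inr ⟨hu, huv, hI (by exact_mod_cast hvI) (by exact_mod_cast hu) (Ne.symm huv)⟩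
      · rintro (rfl | h)
        · exact hvI
        · exact h.1
    · rintro rfl
      refine ⟨⟨?_, ?_⟩, by simp⟩
      · rw [Finset.coe_insert]
        exact hO.insert fun u hu _ => ⟨(hv u hu).2, fun h => (hv u hu).2 h.symm⟩
      · rw [Finset.filter_insert, if_neg (by simp), Finset.filter_true_of_mem hv]
  · refine Finset.sum_nbij' (fun I => I.filter (G.Adj v)) (fun A => O ∪ A) ?_ ?_ ?_ ?_ ?_
    · intro I hI
      simp only [Finset.mem_filter, mem_indepSubsets, Finset.subset_univ, true_and] at hI ⊢
      obtain ⟨⟨hI, rfl⟩, hvI⟩ := hI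
      refine ⟨fun u hu => ?_, hI.mono (Finset.coe_subset.2 (Finset.filter_subset _ _))⟩
      simp only [Finset.mem_filter, Finset.mem_univ, true_and] at hu ⊢
      refine ⟨hu.2, fun w hw hadj => ?_⟩
      exact hI (by exact_mod_cast hu.1) (by exact_mod_cast hw.1) hadj.ne hadj
    · intro A hA
      simp only [Finset.mem_filter, mem_indepSubsets, Finset.subset_univ, true_and] at hA ⊢
      obtain ⟨hAJ, hA⟩ := hA
      have hAJ' : ∀ u ∈ A, G.Adj v u ∧ ∀ w ∈ O, ¬ G.Adj u w := fun u hu => by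
        simpa using hAJ hu
      refine ⟨⟨?_, ?_⟩, ?_⟩
      · intro x hx y hy hxy hadj
        simp only [Finset.coe_union, Set.mem_union, Finset.mem_coe] at hx hy
        rcases hx with hx | hx <;> rcases hy with hy | hy
        · exact hO hx hy hxy hadj
        · exact (hAJ' y hy).2 x hx hadj.symm
        · exact (hAJ' x hx).2 y hy hadj
        · exact hA hx hy hxy hadj
      · rw [Finset.filter_union, Finset.filter_true_of_mem hv, Finset.filter_false_of_mem,
          Finset.union_empty]
        exact fun u hu h => h.2 (hAJ' u hu).1
      · rw [Finset.mem_union, not_or]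
        exact ⟨hvO, fun h => (hAJ' v h).1.ne rfl⟩
    · intro I hI
      simp only [Finset.mem_filter, mem_indepSubsets, Finset.subset_univ, true_and] at hI
      obtain ⟨⟨hI, rfl⟩, hvI⟩ := hI
      ext u
      simp only [Finset.mem_union, Finset.mem_filter]
      have : u ∈ I → u ≠ v := fun h h' => hvI (h' ▸ h)
      tauto
    · intro A hA
      rw [mem_indepSubsets] at hA
      rw [Finset.filter_union, Finset.filter_false_of_mem fun u hu => (hv u hu).2,
        Finset.filter_true_of_mem, Finset.empty_union]
      exact fun u hu => (Finset.mem_filter.1 (hA.1 hu)).2.1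
    · intro I hI
      simp only [Finset.mem_filter, mem_indepSubsets, Finset.subset_univ, true_and] at hI
      obtain ⟨⟨hI, rfl⟩, hvI⟩ := hI
      congr 1
      ext u
      simp only [Finset.mem_union, Finset.mem_filter]
      have : u ∈ I → u ≠ v := fun h h' => hvI (h' ▸ h)
      tauto

open Classical in
/-- In the hard-core model, a vertex and its neighbourhood are occupied often enough. -/
lemma mul_hardCore_le_sum (hl : 0 ≤ l) (hl1 : l ≤ 1)
    (hM : l ^ 2 * ∑ u with G.Adj v u,
      (((Finset.univ.filter (G.Adj v)).filter (G.Adj u)).card : ℝ) ≤ 1)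
    {B D : ℝ} (hB : 0 ≤ B) (hD : Real.exp (6 * B + 1) ≤ l * D) :
    B * G.hardCore l Finset.univ ≤ ∑ I ∈ G.indepSubsets Finset.univ,
      ((if v ∈ I then D else 0) + (I.filter (G.Adj v)).card) * l ^ I.card := by
  rw [hardCore, Finset.mul_sum, ← sub_nonneg, ← Finset.sum_sub_distrib]
  -- Conditioning on the part `O` outside the closed neighbourhood of `v`: the inequality holds on
  -- each fibre separately, where it is `mul_add_hardCore_le` times `l ^ O.card`.
  rw [← Finset.sum_fiberwise_of_maps_to (t := G.indepSubsets Finset.univ)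
    (g := fun I => I.filter (fun u => u ≠ v ∧ ¬ G.Adj v u))]
  swap
  · intro I hI
    rw [mem_indepSubsets] at hI ⊢
    exact ⟨Finset.subset_univ _, hI.2.mono (Finset.coe_subset.2 (Finset.filter_subset _ _))⟩
  refine Finset.sum_nonneg fun O hO => ?_
  by_cases hv : ∀ u ∈ O, u ≠ v ∧ ¬ G.Adj v u
  swap
  · rw [Finset.filter_false_of_mem, Finset.sum_empty]
    rintro I - rfl
    exact hv fun u hu => (Finset.mem_filter.1 hu).2
  rw [sum_indepSubsets_fiber (mem_indepSubsets.1 hO).2 hv]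
  set J := Finset.univ.filter fun u => G.Adj v u ∧ ∀ w ∈ O, ¬ G.Adj u w with hJ
  have hvO : v ∉ O := fun h => (hv v h).1 rfl
  have hJN : J ⊆ Finset.univ.filter (G.Adj v) := fun u hu => by
    simp only [hJ, Finset.mem_filter, Finset.mem_univ, true_and] at hu ⊢
    exact hu.1
  have hMJ : l ^ 2 * ∑ u ∈ J, ((J.filter (G.Adj u)).card : ℝ) ≤ 1 := by
    refine le_trans (mul_le_mul_of_nonneg_left ?_ (sq_nonneg l)) hM
    refine (Finset.sum_le_sum fun u _ => ?_).trans
      (Finset.sum_le_sum_of_subset_of_nonneg hJN fun u _ _ => Nat.cast_nonneg _)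
    exact_mod_cast Finset.card_le_card (Finset.filter_subset_filter _ hJN)
  have key := mul_add_hardCore_le hl hl1 hMJ hB hD
  have h1 : ∀ A ∈ G.indepSubsets J,
      ((if v ∈ O ∪ A then D else 0) + ((O ∪ A).filter (G.Adj v)).card) * l ^ (O ∪ A).card -
        B * l ^ (O ∪ A).card = l ^ O.card * (A.card * l ^ A.card - B * l ^ A.card) := by
    intro A hA
    have hAJ : ∀ u ∈ A, G.Adj v u := fun u hu => by
      simpa using hJN ((mem_indepSubsets.1 hA).1 hu)
    have hdisj : Disjoint O A := Finset.disjoint_left.2 fun u hu hu' => (hv u hu).2 (hAJ u hu')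
    have hvA : v ∉ O ∪ A := by
      rw [Finset.mem_union, not_or]
      exact ⟨hvO, fun h => (hAJ v h).ne rfl⟩
    rw [if_neg hvA, Finset.filter_union, Finset.filter_false_of_mem fun u hu => (hv u hu).2,
      Finset.filter_true_of_mem hAJ, Finset.empty_union, Finset.card_union_of_disjoint hdisj,
      pow_add]
    ring
  rw [Finset.sum_congr rfl h1, ← Finset.mul_sum, Finset.sum_sub_distrib, ← Finset.mul_sum,
    if_pos (Finset.mem_insert_self v O), Finset.card_insert_of_notMem hvO, pow_succ]
  have h2 : (0 : ℝ) ≤ ((insert v O).filter (G.Adj v)).card := Nat.cast_nonneg _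
  have h3 : 0 ≤ l ^ O.card := pow_nonneg hl _
  rw [hardCore] at key
  have h4 := mul_nonneg h3 (sub_nonneg.2 key)
  have h5 := mul_nonneg (mul_nonneg h2 h3) hl
  nlinarith

open Classical in
/-- **Independence number of locally sparse graphs.** -/
theorem mul_card_le_of_locally_sparse (hl : 0 ≤ l) (hl1 : l ≤ 1)
    (hM : ∀ v, l ^ 2 * ∑ u with G.Adj v u,
      (((Finset.univ.filter (G.Adj v)).filter (G.Adj u)).card : ℝ) ≤ 1)
    {B D a : ℝ} (hB : 0 ≤ B) (hD : Real.exp (6 * B + 1) ≤ l * D)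
    (hdeg : ∀ v, ((Finset.univ.filter (G.Adj v)).card : ℝ) ≤ D)
    (ha : ∀ A : Finset V, G.IsIndepSet A → (A.card : ℝ) ≤ a) :
    B * Fintype.card V ≤ 2 * D * a := by
  have hZ : 1 ≤ G.hardCore l Finset.univ := one_le_hardCore hl
  have hD0 : 0 ≤ D := by
    by_contra! h
    nlinarith [Real.exp_pos (6 * B + 1)]
  refine le_of_mul_le_mul_right ?_ (zero_lt_one.trans_le hZ)
  -- Summed over `v`, a fixed `I` contributes `D * |I|` plus the degrees of its vertices, so at most
  -- `2 * D * |I|`.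
  have h1 := Finset.sum_le_sum fun v (_ : v ∈ Finset.univ) =>
    mul_hardCore_le_sum hl hl1 (hM v) hB hD
  rw [Finset.sum_const, nsmul_eq_mul, Finset.sum_comm, Finset.card_univ] at h1
  calc B * Fintype.card V * G.hardCore l Finset.univ
      = Fintype.card V * (B * G.hardCore l Finset.univ) := by ring
    _ ≤ _ := h1
    _ ≤ ∑ I ∈ G.indepSubsets Finset.univ, 2 * D * a * l ^ I.card := by
        refine Finset.sum_le_sum fun I hI => ?_
        rw [← Finset.sum_mul]
        refine mul_le_mul_of_nonneg_right ?_ (pow_nonneg hl _)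
        rw [Finset.sum_add_distrib]
        have h2 : ∑ v, (if v ∈ I then D else 0) = I.card * D := by
          rw [← Finset.sum_filter, Finset.sum_const, nsmul_eq_mul]
          simp
        have h3 : ∑ v, ((I.filter (G.Adj v)).card : ℝ) ≤ I.card * D := by
          have : ∑ v, ((I.filter (G.Adj v)).card : ℝ) =
              ∑ u ∈ I, ((Finset.univ.filter (G.Adj u)).card : ℝ) := by
            simp only [Finset.card_filter, Nat.cast_sum]
            rw [Finset.sum_comm]
            simp only [G.adj_comm]
          rw [this, ← nsmul_eq_mul]
          exact Finset.sum_le_card_nsmul _ _ _ fun u _ => hdeg u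
        have h4 := mul_le_mul_of_nonneg_right (ha I (mem_indepSubsets.1 hI).2) hD0
        linarith
    _ = 2 * D * a * G.hardCore l Finset.univ := by rw [hardCore, Finset.mul_sum]

end SimpleGraph

/-! ### Counting words and close pairs in Johnson balls -/

section BinaryWords

variable {n : ℕ}

lemma card_filter_one_zero_add_one_one (x y : Fin n → Fin 2) :
    (Finset.univ.filter fun k => x k = 1 ∧ y k = 0).card +
      (Finset.univ.filter fun k => x k = 1 ∧ y k = 1).card = hammingNorm x := by
  rw [hammingNorm, ← Finset.card_union_of_disjoint]
  · congr 1
    ext k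
    simp only [Finset.mem_union, Finset.mem_filter, Finset.mem_univ, true_and]
    generalize x k = a, y k = b
    revert a b
    decide
  · refine Finset.disjoint_filter.2 fun k _ h h' => ?_
    simp [h.2] at h'

lemma card_filter_one_zero_add_zero_one (x y : Fin n → Fin 2) :
    (Finset.univ.filter fun k => x k = 1 ∧ y k = 0).card +
      (Finset.univ.filter fun k => x k = 0 ∧ y k = 1).card = hammingDist x y := by
  rw [hammingDist, ← Finset.card_union_of_disjoint]
  · congr 1
    ext k
    simp only [Finset.mem_union, Finset.mem_filter, Finset.mem_univ, true_and]
    generalize x k = a, y k = b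
    revert a b
    decide
  · refine Finset.disjoint_filter.2 fun k _ h h' => ?_
    simp [h.2] at h'

lemma card_filter_one_zero_eq {x y : Fin n → Fin 2} (h : hammingNorm x = hammingNorm y) :
    (Finset.univ.filter fun k => x k = 1 ∧ y k = 0).card =
      (Finset.univ.filter fun k => x k = 0 ∧ y k = 1).card := by
  have h1 := card_filter_one_zero_add_one_one x y
  have h2 := card_filter_one_zero_add_one_one y x
  simp only [and_comm (a := y _ = 1)] at h2
  omega

lemma hammingDist_eq_two_mul {x y : Fin n → Fin 2} (h : hammingNorm x = hammingNorm y) :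
    hammingDist x y = 2 * (Finset.univ.filter fun k => x k = 1 ∧ y k = 0).card := by
  rw [← card_filter_one_zero_add_zero_one, ← card_filter_one_zero_eq h, two_mul]

lemma card_hammingNorm_eq (n w : ℕ) :
    Fintype.card {x : Fin n → Fin 2 // hammingNorm x = w} = n.choose w := by
  rw [Fintype.card_subtype]
  conv_rhs => rw [← Fintype.card_fin n, ← Finset.card_univ, ← Finset.card_powersetCard]
  refine Finset.card_nbij' (fun x => Finset.univ.filter fun k => x k ≠ 0)
    (fun A k => if k ∈ A then 1 else 0) ?_ ?_ ?_ ?_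
  · intro x hx
    simpa [Finset.mem_powersetCard, hammingNorm] using hx
  · intro A hA
    simpa [Finset.mem_powersetCard, hammingNorm] using hA
  · intro x _
    ext k
    simp only [Finset.mem_filter, Finset.mem_univ, true_and]
    generalize x k = a
    revert a
    decide
  · intro A _
    ext k
    simp

/-- The Johnson ball around a word of weight `w` has volume `johnsonBallVolume w n d`. -/
lemma card_johnsonBall {w : ℕ} (d : ℕ) {x : Fin n → Fin 2} (hx : hammingNorm x = w) :
    (Finset.univ.filter fun y : Fin n → Fin 2 =>
      hammingNorm y = w ∧ hammingDist x y ≤ 2 * d).card = johnsonBallVolume w n d := by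
  set X := Finset.univ.filter fun k => x k ≠ 0 with hX
  have hXw : X.card = w := hx
  have hXc : Xᶜ.card = n - w := by rw [Finset.card_compl, hXw, Fintype.card_fin]
  have hV : johnsonBallVolume w n d = ((Finset.range (d + 1)).sigma fun i =>
      X.powersetCard i ×ˢ Xᶜ.powersetCard i).card := by
    simp only [Finset.card_sigma, Finset.card_product, Finset.card_powersetCard, hXw, hXc,
      johnsonBallVolume]
  have h01 : ∀ a : Fin 2, a ≠ 0 ↔ a = 1 := by decide
  rw [hV]
  -- A word of the ball is encoded by its two flip sets, inside and outside the support of `x`;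
  -- equal weight forces them to have the same size `i`.
  refine Finset.card_nbij'
    (fun y => ⟨(Finset.univ.filter fun k => x k = 1 ∧ y k = 0).card,
      (Finset.univ.filter fun k => x k = 1 ∧ y k = 0,
        Finset.univ.filter fun k => x k = 0 ∧ y k = 1)⟩)
    (fun p k => if k ∈ p.2.1 then 0 else if k ∈ p.2.2 then 1 else x k) ?_ ?_ ?_ ?_
  · intro y hy
    replace hy := (Finset.mem_filter.1 (Finset.mem_coe.1 hy)).2
    have h1 := hammingDist_eq_two_mul (hx.trans hy.1.symm)
    have h2 := card_filter_one_zero_eq (hx.trans hy.1.symm)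
    simp only [Finset.mem_coe, Finset.mem_sigma, Finset.mem_range, Finset.mem_product,
      Finset.mem_powersetCard]
    refine ⟨by omega, ⟨?_, trivial⟩, ?_, h2.symm⟩
    · intro k hk
      simp only [Finset.mem_filter, Finset.mem_univ, true_and] at hk
      simp [hX, hk.1]
    · intro k hk
      simp only [Finset.mem_filter, Finset.mem_univ, true_and] at hk
      simp [hX, hk.1]
  · rintro ⟨i, P, Q⟩ hp
    simp only [Finset.mem_coe, Finset.mem_sigma, Finset.mem_range, Finset.mem_product,
      Finset.mem_powersetCard] at hp
    obtain ⟨hi, ⟨hP, hPi⟩, hQ, hQi⟩ := hp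
    have hP1 : ∀ k ∈ P, x k = 1 := fun k hk => by
      have := hP hk
      simpa [hX, h01] using this
    have hQ1 : ∀ k ∈ Q, x k = 0 := fun k hk => by
      have := hQ hk
      simpa [hX] using this
    set y : Fin n → Fin 2 := fun k => if k ∈ P then 0 else if k ∈ Q then 1 else x k with hy
    have e1 : (Finset.univ.filter fun k => x k = 1 ∧ y k = 0) = P := by
      ext k
      simp only [Finset.mem_filter, Finset.mem_univ, true_and, hy]
      have := hP1 k
      have := hQ1 k
      split_ifs <;> simp_all
    have e2 : (Finset.univ.filter fun k => x k = 0 ∧ y k = 1) = Q := by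
      ext k
      simp only [Finset.mem_filter, Finset.mem_univ, true_and, hy]
      have := hP1 k
      have := hQ1 k
      split_ifs <;> simp_all
    have h1 := card_filter_one_zero_add_one_one x y
    have h2 := card_filter_one_zero_add_one_one y x
    have h3 := card_filter_one_zero_add_zero_one x y
    simp only [and_comm (a := y _ = 1)] at h2
    rw [e1] at h1 h3
    rw [e2] at h2 h3
    refine Finset.mem_coe.2 (Finset.mem_filter.2 ⟨Finset.mem_univ _, ?_⟩)
    change hammingNorm y = w ∧ hammingDist x y ≤ 2 * d
    constructor <;> omega
  · intro y _
    ext k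
    simp only [Finset.mem_filter, Finset.mem_univ, true_and]
    generalize x k = a, y k = b
    revert a b
    decide
  · rintro ⟨i, P, Q⟩ hp
    simp only [Finset.mem_coe, Finset.mem_sigma, Finset.mem_range, Finset.mem_product,
      Finset.mem_powersetCard] at hp
    obtain ⟨hi, ⟨hP, rfl⟩, hQ, hQi⟩ := hp
    have hP1 : ∀ k ∈ P, x k = 1 := fun k hk => by
      have := hP hk
      simpa [hX, h01] using this
    have hQ1 : ∀ k ∈ Q, x k = 0 := fun k hk => by
      have := hQ hk
      simpa [hX] using this
    have e1 : (Finset.univ.filter fun k => x k = 1 ∧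
        (if k ∈ P then 0 else if k ∈ Q then 1 else x k) = 0) = P := by
      ext k
      simp only [Finset.mem_filter, Finset.mem_univ, true_and]
      have := hP1 k
      have := hQ1 k
      split_ifs <;> simp_all
    have e2 : (Finset.univ.filter fun k => x k = 0 ∧
        (if k ∈ P then 0 else if k ∈ Q then 1 else x k) = 1) = Q := by
      ext k
      simp only [Finset.mem_filter, Finset.mem_univ, true_and]
      have := hP1 k
      have := hQ1 k
      split_ifs <;> simp_all
    simp only [e1, e2]

/-- The pairs of words of weight `w` at Johnson distance at most `d` from each other and from
`x`. -/
def johnsonTriangles (w d : ℕ) (x : Fin n → Fin 2) :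
    Finset ((Fin n → Fin 2) × (Fin n → Fin 2)) :=
  Finset.univ.filter fun p => (hammingNorm p.1 = w ∧ hammingDist x p.1 ≤ 2 * d) ∧
    (hammingNorm p.2 = w ∧ hammingDist x p.2 ≤ 2 * d) ∧ hammingDist p.1 p.2 ≤ 2 * d

/-- Diagonal pairs count as triangles. Hence a bound on triangles also forces the ball to be large,
which later keeps the fugacity at most `1`. -/
lemma johnsonBallVolume_le_card_johnsonTriangles {w : ℕ} (d : ℕ) {x : Fin n → Fin 2}
    (hx : hammingNorm x = w) : johnsonBallVolume w n d ≤ (johnsonTriangles w d x).card := by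
  rw [← card_johnsonBall d hx]
  refine Finset.card_le_card_of_injOn (fun y => (y, y)) ?_ fun y _ z _ h => (Prod.ext_iff.1 h).1
  intro y hy
  simpa [johnsonTriangles] using hy

lemma prod_ite_eq_pow_mul_pow (x y : Fin n → Fin 2) (p q : ℝ) :
    ∏ k, (if x k = y k then 1 else if x k = 1 then p else q) =
      p ^ (Finset.univ.filter fun k => x k = 1 ∧ y k = 0).card *
        q ^ (Finset.univ.filter fun k => x k = 0 ∧ y k = 1).card := by
  rw [← Finset.prod_const, ← Finset.prod_const, Finset.prod_filter, Finset.prod_filter,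
    ← Finset.prod_mul_distrib]
  refine Finset.prod_congr rfl fun k _ => ?_
  generalize x k = a, y k = b
  fin_cases a <;> fin_cases b <;> simp

lemma sum_sum_prod_eq_prod_sum_sum (g : Fin n → Fin 2 → Fin 2 → ℝ) :
    ∑ p : (Fin n → Fin 2) × (Fin n → Fin 2), ∏ k, g k (p.1 k) (p.2 k) =
      ∏ k, ∑ a, ∑ b, g k a b := by
  simp only [← Fintype.sum_prod_type' (fun a b => g _ a b)]
  rw [Fintype.prod_sum]
  exact (Equiv.sum_comp (Equiv.arrowProdEquivProdArrow (Fin n) (fun _ => Fin 2) fun _ => Fin 2)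
    fun p => ∏ k, g k (p.1 k) (p.2 k)).symm

/-- A Chernoff bound for the number of pairs of neighbours of `x` that are close to each
other. -/
lemma card_johnsonTriangles_mul_le {w : ℕ} (d : ℕ) {x : Fin n → Fin 2} (hx : hammingNorm x = w)
    {p q s : ℝ} (hp : 0 ≤ p) (hq : 0 ≤ q) (hpq : p * q ≤ 1) (hs : 0 ≤ s) (hs1 : s ≤ 1) :
    (johnsonTriangles w d x).card * ((p ^ d * q ^ d) ^ 2 * s ^ (2 * d)) ≤
      (1 + 2 * p * s + p ^ 2) ^ w * (1 + 2 * q * s + q ^ 2) ^ (n - w) := by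
  -- The weights `p` and `q` mark the two kinds of flips from `x`, and `s` marks disagreements
  -- within the pair. As `p * q ≤ 1` and `s ≤ 1`, every admissible pair weighs at least its value at
  -- the extreme distances; the sum over all pairs factors over coordinates.
  set φ : Fin 2 → Fin 2 → ℝ := fun a b => if a = b then 1 else if a = 1 then p else q with hφ
  set σ : Fin 2 → Fin 2 → ℝ := fun a b => if a = b then 1 else s with hσ
  have hφ0 : ∀ a b, 0 ≤ φ a b := fun a b => by
    simp only [hφ]; split_ifs <;> first | assumption | exact zero_le_one
  have hσ0 : ∀ a b, 0 ≤ σ a b := fun a b => by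
    simp only [hσ]; split_ifs <;> first | assumption | exact zero_le_one
  have h1 : ∀ y : Fin n → Fin 2, hammingNorm y = w → hammingDist x y ≤ 2 * d →
      p ^ d * q ^ d ≤ ∏ k, φ (x k) (y k) := by
    intro y hy hxy
    have e := hx.trans hy.symm
    rw [hammingDist_eq_two_mul e] at hxy
    rw [prod_ite_eq_pow_mul_pow, ← card_filter_one_zero_eq e, ← mul_pow, ← mul_pow]
    exact pow_le_pow_of_le_one (mul_nonneg hp hq) hpq (by omega)
  have h2 : ∀ y z : Fin n → Fin 2, hammingDist y z ≤ 2 * d →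
      s ^ (2 * d) ≤ ∏ k, σ (y k) (z k) := by
    intro y z hyz
    have : ∏ k, σ (y k) (z k) = s ^ hammingDist y z := by
      rw [hammingDist, ← Finset.prod_const, Finset.prod_filter]
      exact Finset.prod_congr rfl fun k _ => by simp [hσ, ite_not]
    rw [this]
    exact pow_le_pow_of_le_one hs hs1 hyz
  have hpd : 0 ≤ p ^ d * q ^ d := by positivity
  calc (johnsonTriangles w d x).card * ((p ^ d * q ^ d) ^ 2 * s ^ (2 * d))
      = ∑ _y ∈ johnsonTriangles w d x, (p ^ d * q ^ d) ^ 2 * s ^ (2 * d) := by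
        rw [Finset.sum_const, nsmul_eq_mul]
    _ ≤ ∑ y ∈ johnsonTriangles w d x,
          ∏ k, (φ (x k) (y.1 k) * φ (x k) (y.2 k) * σ (y.1 k) (y.2 k)) := by
        refine Finset.sum_le_sum fun y hy => ?_
        simp only [johnsonTriangles, Finset.mem_filter, Finset.mem_univ, true_and] at hy
        rw [Finset.prod_mul_distrib, Finset.prod_mul_distrib, sq]
        have a1 := h1 _ hy.1.1 hy.1.2
        have a2 := h1 _ hy.2.1.1 hy.2.1.2
        have a3 := h2 _ _ hy.2.2
        gcongr
    _ ≤ ∑ y : (Fin n → Fin 2) × (Fin n → Fin 2),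
          ∏ k, (φ (x k) (y.1 k) * φ (x k) (y.2 k) * σ (y.1 k) (y.2 k)) :=
        Finset.sum_le_sum_of_subset_of_nonneg (Finset.subset_univ _) fun y _ _ =>
          Finset.prod_nonneg fun k _ => mul_nonneg (mul_nonneg (hφ0 _ _) (hφ0 _ _)) (hσ0 _ _)
    _ = ∏ k, ∑ a, ∑ b, φ (x k) a * φ (x k) b * σ a b :=
        sum_sum_prod_eq_prod_sum_sum fun k a b => φ (x k) a * φ (x k) b * σ a b
    _ = ∏ k, if x k ≠ 0 then 1 + 2 * p * s + p ^ 2 else 1 + 2 * q * s + q ^ 2 := by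
        refine Finset.prod_congr rfl fun k _ => ?_
        generalize x k = a
        fin_cases a <;> simp [hφ, hσ, Fin.sum_univ_two] <;> ring
    _ = _ := by
        rw [Finset.prod_ite, Finset.prod_const, Finset.prod_const]
        have e1 : (Finset.univ.filter fun k => x k ≠ 0).card = w := hx
        have e2 := Finset.card_filter_add_card_filter_not (s := Finset.univ) fun k => x k ≠ 0
        rw [Finset.card_univ, Fintype.card_fin] at e2
        rw [e1]
        congr 2
        omega

end BinaryWords

/-! ### Tilting at the binomial mode and the sparsity exponent -/

section Mode

/-- `d` is a mode of the binomial distribution with mean `d`. -/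
lemma choose_mul_pow_le_choose_mul_pow {m d : ℕ} (hd : 0 < d) (hdm : d < m) (k : ℕ) :
    (m.choose k : ℝ) * ((d : ℝ) / (m - d)) ^ k ≤ m.choose d * ((d : ℝ) / (m - d)) ^ d := by
  have hmd : (0 : ℝ) < m - d := sub_pos.2 (by exact_mod_cast hdm)
  have hd' : (0 : ℝ) < d := by exact_mod_cast hd
  set u : ℕ → ℝ := fun k => (m.choose k : ℝ) * ((d : ℝ) / (m - d)) ^ k with hu
  have hu0 : ∀ k, 0 ≤ u k := fun k => by positivity
  have hstep : ∀ k, k ≤ m → u (k + 1) * ((k + 1) * (m - d)) = u k * ((m - k) * d) := by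
    intro k hk
    have h := congrArg (Nat.cast (R := ℝ)) (Nat.choose_succ_right_eq m k)
    push_cast [Nat.cast_sub hk] at h
    simp only [hu, pow_succ]
    have : ((d : ℝ) / (m - d)) * (m - d) = d := div_mul_cancel₀ _ hmd.ne'
    calc _ = ((m.choose (k + 1) : ℝ) * (k + 1)) * ((d : ℝ) / (m - d)) ^ k *
          (((d : ℝ) / (m - d)) * (m - d)) := by ring
      _ = _ := by rw [h, this]; ring
  have hup : ∀ k, k < d → u k ≤ u (k + 1) := by
    intro k hk
    have hk' : (k : ℝ) + 1 ≤ d := by exact_mod_cast hk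
    refine le_of_mul_le_mul_right ?_ (show (0 : ℝ) < (k + 1) * (m - d) by positivity)
    rw [hstep k (hk.trans hdm).le]
    refine mul_le_mul_of_nonneg_left ?_ (hu0 k)
    rw [mul_comm]
    exact mul_le_mul (by linarith) hk' (by positivity) (by linarith)
  have hdown : ∀ k, d ≤ k → u (k + 1) ≤ u k := by
    intro k hk
    rcases le_total k m with hkm | hkm
    · have hk' : (d : ℝ) ≤ k := by exact_mod_cast hk
      refine le_of_mul_le_mul_right ?_ (show (0 : ℝ) < (k + 1) * (m - d) by positivity)
      rw [hstep k hkm]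
      refine mul_le_mul_of_nonneg_left ?_ (hu0 k)
      rw [mul_comm]
      exact mul_le_mul (by linarith) (by linarith)
        (sub_nonneg.2 (by exact_mod_cast hkm)) (by positivity)
    · simp only [hu, Nat.choose_eq_zero_of_lt (Nat.lt_succ_of_le hkm)]
      simpa using hu0 k
  rcases le_total k d with h | h
  · refine Nat.decreasingInduction' (P := fun j => u j ≤ u d) (fun j hj _ ih => ?_) h le_rfl
    exact (hup j hj).trans ih
  · exact Nat.le_induction (P := fun j _ => u j ≤ u d) le_rfl
      (fun j hj ih => (hdown j hj).trans ih) k h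

/-- The expansion has `m + 1` terms, none above the modal one, so this tilt loses only a polynomial
factor. -/
lemma one_add_pow_le_mul_choose {m d : ℕ} (hd : 0 < d) (hdm : d < m) :
    (1 + (d : ℝ) / (m - d)) ^ m ≤ (m + 1) * (m.choose d * ((d : ℝ) / (m - d)) ^ d) := by
  rw [add_comm, add_pow]
  calc _ ≤ ∑ _k ∈ Finset.range (m + 1), (m.choose d * ((d : ℝ) / (m - d)) ^ d) := by
        refine Finset.sum_le_sum fun k _ => ?_
        rw [one_pow, mul_one, mul_comm]
        exact choose_mul_pow_le_choose_mul_pow hd hdm k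
    _ = _ := by simp

/-- With `p = d / (m - d)`, the base is `(1 + p) ^ 2 - 2 * p * (1 - s)`, and `p / (1 + p) ^ 2 = (d /
m) * (1 - d / m)`; then `1 - x ≤ exp (-x)`. -/
lemma pow_le_sq_mul_exp {m d : ℕ} (hd : 0 < d) (hdm : d < m) (s : ℝ) (hs : 0 ≤ s) :
    (1 + 2 * ((d : ℝ) / (m - d)) * s + ((d : ℝ) / (m - d)) ^ 2) ^ m ≤
      ((m + 1) * (m.choose d * ((d : ℝ) / (m - d)) ^ d)) ^ 2 *
        Real.exp (-(2 * d * (1 - d / m) * (1 - s))) := by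
  have hmd : (0 : ℝ) < m - d := sub_pos.2 (by exact_mod_cast hdm)
  have hd' : (0 : ℝ) < d := by exact_mod_cast hd
  have hm : (0 : ℝ) < m := by linarith
  have h1 : 1 + 2 * ((d : ℝ) / (m - d)) * s + ((d : ℝ) / (m - d)) ^ 2 ≤
      (1 + (d : ℝ) / (m - d)) ^ 2 * Real.exp (-(2 * (d / m) * (1 - d / m) * (1 - s))) := by
    have h2 := Real.add_one_le_exp (-(2 * ((d : ℝ) / m) * (1 - d / m) * (1 - s)))
    refine le_trans (le_of_eq ?_) (mul_le_mul_of_nonneg_left h2 (sq_nonneg _))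
    field_simp
    ring
  calc _ ≤ ((1 + (d : ℝ) / (m - d)) ^ 2 *
        Real.exp (-(2 * (d / m) * (1 - d / m) * (1 - s)))) ^ m :=
        pow_le_pow_left₀ (by positivity) h1 m
    _ = ((1 + (d : ℝ) / (m - d)) ^ m) ^ 2 * Real.exp (-(2 * d * (1 - d / m) * (1 - s))) := by
        rw [mul_pow, ← pow_mul, ← pow_mul, mul_comm 2 m, ← Real.exp_nat_mul]
        congr 2
        field_simp
    _ ≤ _ := by
        gcongr
        exact one_add_pow_le_mul_choose hd hdm

/-- Follows from `(1 - u + u ^ 2 / 2) * (1 + u + u ^ 2 / 2) = 1 + u ^ 4 / 4 ≥ 1`. -/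
lemma exp_neg_le_quadratic {u : ℝ} (hu : 0 ≤ u) : Real.exp (-u) ≤ 1 - u + u ^ 2 / 2 := by
  rw [Real.exp_neg]
  refine inv_le_of_inv_le₀ (by nlinarith [sq_nonneg (u - 1)]) ?_
  refine le_trans ?_ (Real.quadratic_le_exp_of_nonneg hu)
  rw [inv_le_iff_one_le_mul₀ (by nlinarith [sq_nonneg (u - 1)])]
  nlinarith [sq_nonneg (u ^ 2)]

/-- Few pairs in a Johnson ball are close to each other. -/
lemma card_johnsonTriangles_le {n w d : ℕ} {x : Fin n → Fin 2} (hx : hammingNorm x = w)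
    (hd : 0 < d) (hdw : d < w) (hdn : d < n - w) {t : ℝ} (ht : 0 ≤ t)
    (htd : t ≤ 1 - d / w - d / (n - w : ℕ)) :
    ((johnsonTriangles w d x).card : ℝ) ≤
      (johnsonBallVolume w n d) ^ 2 * (n + 1) ^ 4 * Real.exp (-(d * t ^ 2 / 2)) := by
  set m := n - w with hm
  have hd' : (0 : ℝ) < d := by exact_mod_cast hd
  have hwd : (0 : ℝ) < w - d := sub_pos.2 (by exact_mod_cast hdw)
  have hmd : (0 : ℝ) < m - d := sub_pos.2 (by exact_mod_cast hdn)
  have hw0 : (0 : ℝ) < w := by linarith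
  have hm0 : (0 : ℝ) < m := by linarith
  set a : ℝ := d / w with ha
  set b : ℝ := d / m with hb
  set p : ℝ := d / (w - d) with hp
  set q : ℝ := d / (m - d) with hq
  have hp0 : 0 < p := by positivity
  have hq0 : 0 < q := by positivity
  have ha0 : 0 < a := by positivity
  have hb0 : 0 < b := by positivity
  have hpq : p * q ≤ 1 := by
    have hab : a + b ≤ 1 := by linarith
    rw [ha, hb, div_add_div _ _ hw0.ne' hm0.ne', div_le_one (by positivity)] at hab
    rw [hp, hq, div_mul_div_comm, div_le_one (by positivity)]
    nlinarith
  -- The marker `s` costs `exp (d * t)` and gains `exp (-2 * d * (2 - a - b) * (1 - s))`. Since `2 -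
  -- a - b ≥ 1 + t` and `1 - s` is about `t / 2`, the gain wins by at least `d * t ^ 2 / 2` in the
  -- exponent.
  set s : ℝ := Real.exp (-(t / 2)) with hs
  have hs0 : 0 < s := Real.exp_pos _
  have hs1 : s ≤ 1 := Real.exp_le_one_iff.2 (by linarith)
  have hsq : s ≤ 1 - t / 2 + t ^ 2 / 8 := by
    have := exp_neg_le_quadratic (u := t / 2) (by linarith)
    rw [← hs] at this
    nlinarith
  have hsd : s ^ (2 * d) = Real.exp (-(d * t)) := by
    rw [hs, ← Real.exp_nat_mul]
    push_cast
    ring_nf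
  have key := card_johnsonTriangles_mul_le d hx hp0.le hq0.le hpq hs0.le hs1
  have k1 := pow_le_sq_mul_exp hd hdw s hs0.le
  have k2 := pow_le_sq_mul_exp hd hdn s hs0.le
  rw [← hm] at key
  rw [← hp, ← ha] at k1
  rw [← hq, ← hb] at k2
  have hV : ((w.choose d : ℝ) * m.choose d) ≤ johnsonBallVolume w n d := by
    have : w.choose d * m.choose d ≤ johnsonBallVolume w n d :=
      Finset.single_le_sum (f := fun i => w.choose i * (n - w).choose i)
        (fun _ _ => Nat.zero_le _) (Finset.self_mem_range_succ d)
    exact_mod_cast this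
  have hwn : (w : ℝ) + 1 ≤ n + 1 := by
    have : w ≤ n := by omega
    have : (w : ℝ) ≤ n := by exact_mod_cast this
    linarith
  have hmn : (m : ℝ) + 1 ≤ n + 1 := by
    have : (m : ℝ) ≤ n := by exact_mod_cast Nat.sub_le n w
    linarith
  have hexp : Real.exp (-(2 * d * (1 - a) * (1 - s))) * Real.exp (-(2 * d * (1 - b) * (1 - s))) ≤
      Real.exp (-(d * t ^ 2 / 2)) * Real.exp (-(d * t)) := by
    rw [← Real.exp_add, ← Real.exp_add, Real.exp_le_exp]
    have h1 : (d : ℝ) * (2 - a - b) * (t - t ^ 2 / 4) ≤ d * (2 - a - b) * (2 * (1 - s)) :=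
      mul_le_mul_of_nonneg_left (by linarith) (mul_nonneg hd'.le (by linarith))
    have h2 : t ^ 2 / 2 + t ≤ (2 - a - b) * (t - t ^ 2 / 4) := by
      linarith [mul_nonneg ht (sub_nonneg.2 htd), mul_nonneg (sq_nonneg t) (add_pos ha0 hb0).le]
    have h3 := mul_le_mul_of_nonneg_left h2 hd'.le
    linarith
  have hE : 0 < (p ^ d * q ^ d) ^ 2 * s ^ (2 * d) := by positivity
  refine le_of_mul_le_mul_right (key.trans ?_) hE
  calc _ ≤ _ := mul_le_mul k1 k2 (by positivity) (by positivity)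
    _ = ((w + 1) * (m + 1)) ^ 2 * (w.choose d * m.choose d) ^ 2 * (p ^ d * q ^ d) ^ 2 *
        (Real.exp (-(2 * d * (1 - a) * (1 - s))) * Real.exp (-(2 * d * (1 - b) * (1 - s)))) := by
        ring
    _ ≤ ((n + 1) * (n + 1)) ^ 2 * (johnsonBallVolume w n d) ^ 2 * (p ^ d * q ^ d) ^ 2 *
        (Real.exp (-(d * t ^ 2 / 2)) * Real.exp (-(d * t))) := by
        gcongr
    _ = _ := by
        rw [hsd]
        ring

end Mode

/-! ### Codes as independent sets, and the asymptotics -/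

section JohnsonGraph

open Filter Topology

/-- The graph on the words of weight `w` that joins distinct words at Johnson distance at most
`d`. -/
def johnsonBallGraph (n d w : ℕ) : SimpleGraph {x : Fin n → Fin 2 // hammingNorm x = w} where
  Adj x y := x ≠ y ∧ hammingDist x.1 y.1 ≤ 2 * d
  symm := ⟨fun x y h => ⟨h.1.symm, by rw [hammingDist_comm]; exact h.2⟩⟩
  loopless := ⟨fun x h => h.1 rfl⟩

variable {n d w : ℕ}

lemma card_le_maxConstantWeightCodeSize {C : Finset (Fin n → Fin 2)}
    (hC : IsConstantWeightCode n d w C) : C.card ≤ maxConstantWeightCodeSize n d w := by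
  classical
  exact Finset.le_sup (f := Finset.card) (Finset.mem_filter.2 ⟨Finset.mem_univ C, hC⟩)

lemma card_le_of_isIndepSet {A : Finset {x : Fin n → Fin 2 // hammingNorm x = w}}
    (hA : (johnsonBallGraph n d w).IsIndepSet A) :
    A.card ≤ maxConstantWeightCodeSize n (d + 1) w := by
  rw [← Finset.card_map (Function.Embedding.subtype _)]
  refine card_le_maxConstantWeightCodeSize ⟨fun x hx => ?_, fun x hx y hy hxy => ?_⟩
  · obtain ⟨x, -, rfl⟩ := Finset.mem_map.1 hx
    exact x.2
  · obtain ⟨x, hxA, rfl⟩ := Finset.mem_map.1 hx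
    obtain ⟨y, hyA, rfl⟩ := Finset.mem_map.1 hy
    have hne : x ≠ y := fun h => hxy (by rw [h])
    have h1 : ¬ hammingDist x.1 y.1 ≤ 2 * d := fun h => hA hxA hyA hne ⟨hne, h⟩
    -- Equal weights make the Hamming distance even, so exceeding `2 * d` means reaching `2 * (d +
    -- 1)`.
    have h2 := hammingDist_eq_two_mul (x.2.trans y.2.symm)
    have h3 : 2 * (d + 1) ≤ hammingDist x.1 y.1 := by omega
    have h4 : (2 : ℚ) * (d + 1) ≤ hammingDist x.1 y.1 := by exact_mod_cast h3
    simp only [johnsonDist, Function.Embedding.subtype_apply]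
    push_cast
    linarith

lemma johnsonBallVolume_pos (w n d : ℕ) : 0 < johnsonBallVolume w n d := by
  have : w.choose 0 * (n - w).choose 0 ≤ johnsonBallVolume w n d :=
    Finset.single_le_sum (f := fun i => w.choose i * (n - w).choose i)
      (fun _ _ => Nat.zero_le _) (Finset.mem_range.2 d.succ_pos)
  simpa [Nat.pos_iff_ne_zero, Nat.one_le_iff_ne_zero] using this

lemma exists_hammingNorm_eq (hw : w ≤ n) : ∃ x : Fin n → Fin 2, hammingNorm x = w := by
  have h : 0 < Fintype.card {x : Fin n → Fin 2 // hammingNorm x = w} := by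
    rw [card_hammingNorm_eq]
    exact Nat.choose_pos hw
  obtain ⟨x⟩ := Fintype.card_pos_iff.1 h
  exact ⟨x.1, x.2⟩

lemma one_le_maxConstantWeightCodeSize (hw : w ≤ n) : 1 ≤ maxConstantWeightCodeSize n d w := by
  obtain ⟨x, hx⟩ := exists_hammingNorm_eq hw
  refine le_trans (Finset.card_singleton x).ge (card_le_maxConstantWeightCodeSize ⟨?_, ?_⟩)
  · simpa using hx
  · intro y hy z hz h
    rw [Finset.mem_singleton] at hy hz
    exact absurd (hy.trans hz.symm) h

/-- An improvement of the Gilbert–Varshamov bound when balls contain few close pairs. -/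
lemma mul_choose_le_of_card_johnsonTriangles_le (hw : w ≤ n) {μ : ℝ} (hμ : 1 ≤ μ)
    (hT : ∀ x : Fin n → Fin 2, hammingNorm x = w → ((johnsonTriangles w d x).card : ℝ) ≤
      (johnsonBallVolume w n d) ^ 2 * Real.exp (-(2 * μ))) :
    (μ - 1) / 6 * n.choose w ≤
      2 * johnsonBallVolume w n d * maxConstantWeightCodeSize n (d + 1) w := by
  classical
  set v : ℝ := (johnsonBallVolume w n d : ℝ) with hv
  have hv0 : 0 < v := by
    rw [hv]
    exact_mod_cast johnsonBallVolume_pos w n d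
  have hexp : Real.exp (2 * μ) = Real.exp μ ^ 2 := by rw [← Real.exp_nat_mul]; norm_num
  have hv1 : Real.exp μ ≤ v := by
    obtain ⟨x, hx⟩ := exists_hammingNorm_eq hw
    have h1 : v ≤ (johnsonTriangles w d x).card := by
      rw [hv]
      exact_mod_cast johnsonBallVolume_le_card_johnsonTriangles d hx
    have h2 := h1.trans (hT x hx)
    rw [Real.exp_neg, ← div_eq_mul_inv, le_div_iff₀ (Real.exp_pos _), sq] at h2
    have h3 := le_of_mul_le_mul_left h2 hv0
    have h4 : Real.exp μ ≤ Real.exp (2 * μ) := Real.exp_le_exp.2 (by linarith)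
    exact h4.trans h3
  rw [← card_hammingNorm_eq]
  -- The fugacity `exp μ / v` is the largest for which the triangle bound gives `l ^ 2 * T ≤ 1`.
  -- Then `l * D = exp μ`, and `6 * B + 1 = μ` fixes `B`.
  refine SimpleGraph.mul_card_le_of_locally_sparse (G := johnsonBallGraph n d w)
    (l := Real.exp μ / v) (D := v) (by positivity) ((div_le_one hv0).2 hv1) ?_ (by linarith) ?_ ?_
    fun A hA => by exact_mod_cast card_le_of_isIndepSet hA
  · intro x
    set S : Finset {x : Fin n → Fin 2 // hammingNorm x = w} :=
      Finset.univ.filter ((johnsonBallGraph n d w).Adj x) with hS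
    have h1 : ∑ u ∈ S, (S.filter ((johnsonBallGraph n d w).Adj u)).card ≤
        (johnsonTriangles w d x.1).card := by
      rw [← Finset.card_sigma]
      refine Finset.card_le_card_of_injOn (fun p => (p.1.1, p.2.1)) ?_ ?_
      · rintro ⟨y, z⟩ h
        simp only [Finset.coe_sigma, Set.mem_sigma_iff, Finset.mem_coe, Finset.mem_filter,
          hS, Finset.mem_univ, true_and] at h
        simp only [johnsonTriangles, Finset.mem_coe, Finset.mem_filter, Finset.mem_univ,
          true_and]
        exact ⟨⟨y.2, h.1.2⟩, ⟨z.2, h.2.1.2⟩, h.2.2.2⟩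
      · rintro ⟨y, z⟩ - ⟨y', z'⟩ - h
        simp only [Prod.mk.injEq] at h
        obtain rfl := Subtype.ext h.1
        obtain rfl := Subtype.ext h.2
        rfl
    have h2 : (∑ u ∈ S, ((S.filter ((johnsonBallGraph n d w).Adj u)).card : ℝ)) ≤
        v ^ 2 * Real.exp (-(2 * μ)) := by
      refine le_trans ?_ (hT x.1 x.2)
      exact_mod_cast h1
    calc (Real.exp μ / v) ^ 2 * _ ≤ (Real.exp μ / v) ^ 2 * (v ^ 2 * Real.exp (-(2 * μ))) :=
          mul_le_mul_of_nonneg_left h2 (sq_nonneg _)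
      _ = 1 := by
          rw [Real.exp_neg, hexp]
          field_simp
  · rw [div_mul_cancel₀ _ hv0.ne']
    exact Real.exp_le_exp.2 (by linarith)
  · intro x
    have h : (Finset.univ.filter ((johnsonBallGraph n d w).Adj x)).card ≤
        johnsonBallVolume w n d := by
      rw [← card_johnsonBall d x.2]
      refine Finset.card_le_card_of_injOn Subtype.val ?_ Subtype.val_injective.injOn
      intro y hy
      have hy' : (johnsonBallGraph n d w).Adj x y := by simpa using hy
      simpa using ⟨y.2, hy'.2⟩
    rw [hv]
    exact_mod_cast h

/-- The terms `± 1` are the worst effect of rounding on `d / w` and `d / (n - w)`. -/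
lemma tendsto_mul_add_div_mul_sub (a : ℝ) {c : ℝ} (hc : 0 < c) :
    Tendsto (fun n : ℕ => (a * n + 1) / (c * n - 1)) atTop (𝓝 (a / c)) := by
  have h0 := tendsto_one_div_atTop_nhds_zero_nat (𝕜 := ℝ)
  have h : Tendsto (fun n : ℕ => (a + 1 / (n : ℝ)) / (c - 1 / n)) atTop
      (𝓝 ((a + 0) / (c - 0))) :=
    (h0.const_add a).div (h0.const_sub c) (by simpa using hc.ne')
  rw [add_zero, sub_zero] at h
  refine h.congr' ?_
  filter_upwards [eventually_gt_atTop 0] with n hn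
  have hn' : (n : ℝ) ≠ 0 := by exact_mod_cast hn.ne'
  rw [← mul_div_mul_right _ _ hn', add_mul, sub_mul, div_mul_cancel₀ _ hn']

lemma eventually_add_one_pow_le_exp (k : ℕ) {b : ℝ} (hb : 0 < b) :
    ∀ᶠ n : ℕ in atTop, ((n : ℝ) + 1) ^ k ≤ Real.exp (b * n) := by
  have h := (isLittleO_pow_exp_pos_mul_atTop k hb).bound (Real.exp_pos (-b))
  have h1 : Tendsto (fun n : ℕ => (n : ℝ) + 1) atTop atTop :=
    tendsto_atTop_add_const_right _ _ tendsto_natCast_atTop_atTop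
  filter_upwards [h1.eventually h] with n hn
  rw [Real.norm_of_nonneg (by positivity), Real.norm_of_nonneg (Real.exp_pos _).le,
    ← Real.exp_add] at hn
  refine hn.trans (Real.exp_le_exp.2 (by linarith))

/-- The bound with an explicit constant for all large lengths. -/
lemma exists_forall_ge_mul_le_maxConstantWeightCodeSize {α lam : ℝ} (hα : 0 < α)
    (hαlam : α < lam * (1 - lam)) (hlam : 0 < lam) (hlam' : 0 < 1 - lam) :
    ∃ κ : ℝ, 0 < κ ∧ ∃ n₀ : ℕ, ∀ n d w : ℕ, n₀ ≤ n → w ≤ n →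
      |(d : ℝ) - α * n| < 1 → |(w : ℝ) - lam * n| < 1 →
      κ * n * ((n.choose w : ℝ) / (johnsonBallVolume w n d : ℝ)) ≤
        (maxConstantWeightCodeSize n (d + 1) w : ℝ) := by
  -- Half of the limiting gap `1 - α / lam - α / (1 - lam)`; the other half absorbs rounding.
  set t : ℝ := (1 - α / (lam * (1 - lam))) / 2 with ht
  have hfrac : α / (lam * (1 - lam)) < 1 := (div_lt_one (by positivity)).2 hαlam
  have ht0 : 0 < t := by linarith
  have hsum : α / lam + α / (1 - lam) < 1 - t := by
    have : α / lam + α / (1 - lam) = α / (lam * (1 - lam)) := by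
      field_simp
      ring
    linarith
  -- With `d ≥ α * n / 2`, the exponent `d * t ^ 2 / 2` is at least `4 * κ * n`. The factor `(n + 1)
  -- ^ 4` uses up `2 * κ * n`, which leaves `μ = κ * n`.
  set κ : ℝ := α * t ^ 2 / 16 with hκ
  have hκ0 : 0 < κ := by positivity
  have F1 := ((tendsto_mul_add_div_mul_sub α hlam).add
    (tendsto_mul_add_div_mul_sub α hlam')).eventually_lt_const hsum
  have F2 := eventually_add_one_pow_le_exp 4 (b := 2 * κ) (by positivity)
  have hlin : ∀ c : ℝ, 0 < c → ∀ᶠ n : ℕ in atTop, 2 ≤ c * n := fun c hc =>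
    (tendsto_natCast_atTop_atTop.const_mul_atTop hc).eventually_ge_atTop 2
  have hαl : 0 < lam - α := by nlinarith
  have hαl' : 0 < 1 - lam - α := by nlinarith
  obtain ⟨n₀, hn₀⟩ := eventually_atTop.1
    (F1.and (F2.and ((hlin α hα).and ((hlin _ hαl).and ((hlin _ hαl').and (hlin κ hκ0))))))
  -- From `κ * n ≥ 2` one gets `(κ * n - 1) / 6 ≥ κ * n / 12`; the factor `2` in `2 * D * a` halves
  -- this again.
  refine ⟨κ / 24, by positivity, n₀, fun n d w hn hwn hd hw => ?_⟩
  obtain ⟨f1, f2, f3, f4, f5, f6⟩ := hn₀ n hn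
  rw [abs_lt] at hd hw
  have hm : ((n - w : ℕ) : ℝ) = n - w := Nat.cast_sub hwn
  have hd0 : 0 < d := by
    have : (0 : ℝ) < d := by linarith
    exact_mod_cast this
  have hdw : d < w := by
    have : (d : ℝ) < w := by linarith
    exact_mod_cast this
  have hdn : d < n - w := by
    have : (d : ℝ) < (n - w : ℕ) := by rw [hm]; linarith
    exact_mod_cast this
  have htd : t ≤ 1 - d / w - d / (n - w : ℕ) := by
    have h1 : (d : ℝ) / w ≤ (α * n + 1) / (lam * n - 1) :=
      div_le_div₀ (by linarith) (by linarith) (by linarith) (by linarith)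
    have h2 : (d : ℝ) / (n - w : ℕ) ≤ (α * n + 1) / ((1 - lam) * n - 1) :=
      div_le_div₀ (by linarith) (by linarith) (by linarith) (by rw [hm]; linarith)
    linarith
  have hT : ∀ x : Fin n → Fin 2, hammingNorm x = w → ((johnsonTriangles w d x).card : ℝ) ≤
      (johnsonBallVolume w n d) ^ 2 * Real.exp (-(2 * (κ * n))) := by
    intro x hx
    refine (card_johnsonTriangles_le hx hd0 hdw hdn ht0.le htd).trans ?_
    rw [mul_assoc]
    refine mul_le_mul_of_nonneg_left ?_ (by positivity)
    have h1 : Real.exp (-(d * t ^ 2 / 2)) ≤ Real.exp (-(4 * (κ * n))) := by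
      refine Real.exp_le_exp.2 (neg_le_neg ?_)
      have : α * n / 2 ≤ d := by linarith
      have := mul_le_mul_of_nonneg_right this (sq_nonneg t)
      rw [hκ]
      linarith
    calc _ ≤ Real.exp (2 * κ * n) * Real.exp (-(4 * (κ * n))) := by gcongr
      _ = _ := by
        rw [← Real.exp_add]
        ring_nf
  have key := mul_choose_le_of_card_johnsonTriangles_le hwn (by linarith) hT
  have hv0 : (0 : ℝ) < johnsonBallVolume w n d := by exact_mod_cast johnsonBallVolume_pos w n d
  rw [← mul_div_assoc, div_le_iff₀ hv0]
  have h2 : κ * n / 12 * n.choose w ≤ (κ * n - 1) / 6 * n.choose w :=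
    mul_le_mul_of_nonneg_right (by linarith) (Nat.cast_nonneg _)
  linarith

end JohnsonGraph

/-- The integers at distance less than `1` from a real number are exactly its floor and ceiling, so
the absolute-value hypotheses encode both roundings. -/
theorem theorem2p6 (α lam : ℝ) (hα : 0 < α) (hαlam : α < lam * (1 - lam)) :
    ∃ c : ℝ, 0 < c ∧ ∀ n d w : ℕ, 0 < n →
      |(d : ℝ) - α * n| < 1 → |(w : ℝ) - lam * n| < 1 →
      c * n * ((n.choose w : ℝ) / (johnsonBallVolume w n d : ℝ)) ≤
        (maxConstantWeightCodeSize n (d + 1) w : ℝ) := by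
  have hlam : 0 < lam := by nlinarith [sq_nonneg lam]
  have hlam' : 0 < 1 - lam := by nlinarith
  obtain ⟨κ, hκ, n₀, h⟩ :=
    exists_forall_ge_mul_le_maxConstantWeightCodeSize hα hαlam hlam hlam'
  have hpos : (0 : ℝ) < (n₀ + 1) * 2 ^ n₀ := by positivity
  -- The second term of the minimum serves `n ≤ n₀`, where it makes the left side at most `1`, the
  -- size of a one-word code.
  refine ⟨min κ (1 / ((n₀ + 1) * 2 ^ n₀)), by positivity, fun n d w hn hd hw => ?_⟩
  have hwn : w ≤ n := by
    have hn' : (0 : ℝ) < n := by exact_mod_cast hn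
    have : (w : ℝ) < n + 1 := by nlinarith [(abs_lt.1 hw).2]
    exact Nat.lt_succ_iff.1 (by exact_mod_cast this)
  have hv : (1 : ℝ) ≤ johnsonBallVolume w n d := by
    exact_mod_cast johnsonBallVolume_pos w n d
  have hr : (0 : ℝ) ≤ (n.choose w : ℝ) / (johnsonBallVolume w n d : ℝ) := by positivity
  rcases le_total n₀ n with hnn | hnn
  · refine le_trans ?_ (h n d w hnn hwn hd hw)
    have := min_le_left κ (1 / (((n₀ : ℝ) + 1) * 2 ^ n₀))
    gcongr
  · have h1 : (1 : ℝ) ≤ maxConstantWeightCodeSize n (d + 1) w := by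
      exact_mod_cast one_le_maxConstantWeightCodeSize hwn
    refine le_trans ?_ h1
    have hN : (n.choose w : ℝ) ≤ 2 ^ n₀ := by
      exact_mod_cast (Nat.choose_le_two_pow n w).trans (Nat.pow_le_pow_right two_pos hnn)
    have hn' : (n : ℝ) ≤ n₀ + 1 := by
      have : (n : ℝ) ≤ n₀ := by exact_mod_cast hnn
      linarith
    calc _ ≤ 1 / (((n₀ : ℝ) + 1) * 2 ^ n₀) * (n₀ + 1) * 2 ^ n₀ := by
          refine mul_le_mul (mul_le_mul (min_le_right _ _) hn' (Nat.cast_nonneg _)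
            (by positivity)) ((div_le_self (Nat.cast_nonneg _) hv).trans hN) hr (by positivity)
      _ = 1 := by field_simp
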